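/- Let $\mathcal S$ be a finite or countable set, let $p=(p_{xy})_{x,y\in\mathcal S}$ be an irreducible and recurrent transition matrix, and let $m=(m_x)_{x\in\mathcal S}$ be a stationary measure of $p$ with weights $0<m_x<\infty$ (its total mass may be infinite). For a probability measure $\mu$ on $\mathcal S$, a process $(X_n)_{n\in\mathbb Z}$ is called the two-sided Markov chain with transition matrix $p$ and initial distribution $\mu$ if $X_0$ has law $\mu$ and, conditionally on $X_0$, the processes $(X_n)_{n\ge 0}$ and $(X_{-n})_{n\ge 0}$ are independent Markov chains with transition probabilities $p_{xy}$ and $p^*_{xy}=\frac{m_y}{m_x}\,p_{yx}$, respectively; that is, for all $a,b\in\mathbb N_0$ and all states $x_{-a},\dots,x_b$, $$\mathbb P(X_k=x_k \text{ for } -a\le k\le b)=\mu_{x_0}\prod_{k=0}^{b-1}p_{x_kx_{k+1}}\prod_{k=0}^{a-1}p^*_{x_{-k}x_{-k-1}} .$$ Let $X=(X_n)_{n\in\mathbb Z}$ be the two-sided Markov chain with transition matrix $p$ and initial state $X_0=i$, where $i\in\mathcal S$ (initial distribution $\delta_i$), and let $\nu=(\nu_j)_{j\in\mathcal S}$ be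 any probability measure on $\mathcal S$. A random time $T$ (with values in $\mathbb Z\cup\{\infty\}$, almost surely finite) is called non-randomized if it is a measurable function of the trajectory $(X_n)_{n\in\mathbb Z}$. Then the following statements are equivalent. (a) There exists a non-randomized random time $T$ such that $(X_{n+T})_{n\in\mathbb Z}$ is a two-sided Markov chain with transition matrix $p$ and $X_T$ has law $\nu$, i.e. $(X_{n+T})_{n\in\mathbb Z}$ is the two-sided Markov chain with transition matrix $p$ and initial distribution $\nu$. (b) $\frac{m_i}{m_j}\,\nu_j\in\mathbb Z$ for all $j\in\mathcal S$. Moreover, if a random time $T$ as in (a) exists, it can be taken to be a non-negative stopping time, that is, $T\ge 0$ and $\{T\le n\}\in\sigma(X_0,\dots,X_n)$ for all $n\ge 0$. -/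

import Mathlib

open MeasureTheory ProbabilityTheory
open scoped ENNReal NNReal

noncomputable section

namespace TwoSided

variable {S : Type*}

/-- Row `x` of the `n`-step transition matrix `p ^ n`; the row `x` of the transition matrix is the
probability mass function `p x`. -/
def stepDist (p : S → PMF S) : ℕ → S → PMF S
  | 0, x => PMF.pure x
  | n + 1, x => (p x).bind (stepDist p n)

/-- Every state can be reached from every state. -/
def IsIrreducible (p : S → PMF S) : Prop :=
  ∀ x y : S, ∃ n : ℕ, 0 < stepDist p n x y

/-- `firstHitProb p y n x` is the probability that the chain started in `x` visits `y` at time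
`n + 1` and at none of the times `1, …, n`. -/
def firstHitProb (p : S → PMF S) (y : S) : ℕ → S → ℝ≥0∞
  | 0, x => p x y
  | n + 1, x => ∑' z : {z : S // z ≠ y}, p x z * firstHitProb p y n z

/-- From every state the chain returns to that state at some positive time with probability one. -/
def IsRecurrent (p : S → PMF S) : Prop :=
  ∀ x : S, ∑' n : ℕ, firstHitProb p x n x = 1

/-- `m` is a stationary measure with positive (finite) weights; its total mass may be infinite. -/
def IsStationary (p : S → PMF S) (m : S → ℝ≥0) : Prop :=
  (∀ x, 0 < m x) ∧ ∀ y, ∑' x, (m x : ℝ≥0∞) * p x y = m y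

/-- The dual transition probabilities `(m y / m x) * p y x`. -/
def dual (p : S → PMF S) (m : S → ℝ≥0) (x y : S) : ℝ≥0∞ :=
  (m y : ℝ≥0∞) / m x * p y x

/-- `X` is, under `P`, the two-sided Markov chain with transition matrix `p` and initial
distribution `μ`: the state `X 0` has law `μ` and, given `X 0`, the forward chain `(X n)_{n ≥ 0}`
and the backward chain `(X (-n))_{n ≥ 0}` are independent Markov chains with transition matrix `p`
and the dual transition matrix, respectively. This is expressed by the probabilities of all finite
blocks `X (-a) = x (-a), …, X b = x b`. -/
structure IsTwoSidedChain {Ω : Type*} [MeasurableSpace Ω] [MeasurableSpace S]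
    (p : S → PMF S) (m : S → ℝ≥0) (μ : PMF S) (P : Measure Ω) (X : ℤ → Ω → S) : Prop where
  measurable : ∀ n, Measurable (X n)
  prob_block : ∀ (a b : ℕ) (x : ℤ → S),
    P {ω | ∀ k : ℤ, -(a : ℤ) ≤ k → k ≤ (b : ℤ) → X k ω = x k} =
      μ (x 0) * (∏ k ∈ Finset.range b, p (x (k : ℤ)) (x ((k : ℤ) + 1)))
        * ∏ k ∈ Finset.range a, dual p m (x (-(k : ℤ))) (x (-(k : ℤ) - 1))

/-- The shifted process `(X (n + T))_{n ∈ ℤ}`; the value used where `T = ⊤` is irrelevant, as this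
is only used for almost surely finite `T`. -/
def shifted {Ω : Type*} (X : ℤ → Ω → S) (T : Ω → WithTop ℤ) : ℤ → Ω → S :=
  fun n ω => X (n + (T ω).untopD 0) ω

/-- `T` is a measurable function of the trajectory of `X`. -/
def NonRandomized {Ω : Type*} [MeasurableSpace S] (X : ℤ → Ω → S) (T : Ω → WithTop ℤ) : Prop :=
  ∃ τ : (ℤ → S) → WithTop ℤ, Measurable τ ∧ ∀ ω, T ω = τ (fun n => X n ω)

/-- `T` is an almost surely finite random time such that `(X (n + T))_{n ∈ ℤ}` is a two-sided Markov
chain with transition matrix `p` and `X T` has law `ν`. -/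
def IsEmbedding {Ω : Type*} [MeasurableSpace Ω] [MeasurableSpace S]
    (p : S → PMF S) (m : S → ℝ≥0) (ν : PMF S) (P : Measure Ω) (X : ℤ → Ω → S)
    (T : Ω → WithTop ℤ) : Prop :=
  (∀ᵐ ω ∂P, T ω ≠ ⊤) ∧ IsTwoSidedChain p m ν P (shifted X T)

/-- The filtration whose `n`-th σ-algebra is generated by `X 0, …, X n` (trivial for `n < 0`). A
stopping time for it is one for the filtration generated by all `X k` with `k ≤ n` as well. -/
def forwardFiltration {Ω : Type*} [mΩ : MeasurableSpace Ω] [mS : MeasurableSpace S]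
    (X : ℤ → Ω → S) (hX : ∀ n, Measurable (X n)) : Filtration ℤ mΩ where
  seq n := ⨆ k ∈ Set.Icc (0 : ℤ) n, mS.comap (X k)
  mono' _ _ h := biSup_mono fun _ hk => ⟨hk.1, hk.2.trans h⟩
  le' _ := iSup₂_le fun k _ => (hX k).comap_le

end TwoSided

end

/-! Let Q (`statMeasure`) be the law of the two-sided chain started from the weights `m`; it is
shift-invariant and possibly infinite. Every visit to `i` sends one unit of mass to the time that
the random time points to, and `intake` counts the units that arrive at time 0. By invariance
(`transport`), `m i` times the law of the path seen from an almost surely finite T has density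
`intake` with respect to Q. On the other hand, `m i` times the law of the chain started from `ν` has
density `m i * ν j / m j` on the paths in state `j` at time 0. So T is an embedding iff these
densities agree almost everywhere. As `intake` is a cardinality, the ratio must be an integer
(`exists_nat_of_map_jump_eq`).

Conversely, let `k j` be this integer and let each visit to `j` demand `k j` units. Demands are
served last-in-first-out: `matchTime` is the first time at which the demands since time 0 have used
up the supplies since time 0. It looks only at times from 0 on, so it is a non-negative stopping
time. The intake never exceeds the demand, and equals it wherever the demand is fully served. An
unserved demand followed by an unused supply is a configuration that cannot occur again later on the
same path, while recurrence makes the shift conservative; hence unserved demands or unused supplies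
are negligible (`matched_dichotomy`). If demands are served, intake equals demand directly; if
supplies are used, both have the same finite integral `m i`, so the inequality between them is an
equality almost everywhere (`map_jump_matchTime`). -/

noncomputable section

namespace TwoSided

variable {S : Type*}

/-! ### One-sided chains -/

/-- The trajectory started in `x` which at time `n` follows the instruction `u (n, y)` when it is in
state `y`. -/
def traj (x : S) (u : ℕ × S → S) : ℕ → S
  | 0 => x
  | n + 1 => u (n, traj x u n)

theorem traj_eq_iff (x : S) (u : ℕ × S → S) (n : ℕ) (y : ℕ → S) :
    (∀ k ≤ n, traj x u k = y k) ↔ y 0 = x ∧ ∀ k < n, u (k, y k) = y (k + 1) := by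
  induction n with
  | zero => simp [traj, eq_comm]
  | succ n ih =>
    have h1 : (∀ k ≤ n + 1, traj x u k = y k) ↔
        (∀ k ≤ n, traj x u k = y k) ∧ traj x u (n + 1) = y (n + 1) :=
      ⟨fun h => ⟨fun k hk => h k (by omega), h _ le_rfl⟩, fun h k hk => by
        rcases Nat.lt_or_ge n k with h' | h'
        · obtain rfl : k = n + 1 := by omega
          exact h.2
        · exact h.1 k h'⟩
    have h2 : (∀ k < n + 1, u (k, y k) = y (k + 1)) ↔
        (∀ k < n, u (k, y k) = y (k + 1)) ∧ u (n, y n) = y (n + 1) :=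
      Nat.forall_lt_succ_right
    rw [h1, h2, ← and_assoc, ← ih]
    refine and_congr_right fun h => ?_
    rw [traj, h n le_rfl]

theorem measurableSet_initial [MeasurableSpace S] [MeasurableSingletonClass S]
    (n : ℕ) (y : ℕ → S) :
    MeasurableSet {f : ℕ → S | ∀ k ≤ n, f k = y k} := by
  simp only [Set.ofPred_forall]
  exact MeasurableSet.iInter fun k => MeasurableSet.iInter fun _ =>
    measurable_pi_apply k (measurableSet_singleton _)

section Measurability

variable [Countable S] [MeasurableSpace S] [MeasurableSingletonClass S]

theorem measurable_traj (x : S) : Measurable (traj x) := by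
  refine measurable_pi_lambda _ fun n => ?_
  induction n with
  | zero => exact measurable_const
  | succ n ih =>
    have h : Measurable fun q : (ℕ × S → S) × S => q.1 (n, q.2) :=
      measurable_from_prod_countable_left fun y => measurable_pi_apply (n, y)
    exact h.comp (measurable_id.prodMk ih)

/-- The law of the family of independent instructions, the ones for state `y` having law `κ y`. -/
def instructionLaw (κ : S → PMF S) : Measure (ℕ × S → S) :=
  Measure.infinitePi fun a : ℕ × S => (κ a.2).toMeasure

instance (κ : S → PMF S) : IsProbabilityMeasure (instructionLaw κ) := by
  unfold instructionLaw; infer_instance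

/-- The law of the Markov chain with transition matrix `κ` started in `x`. -/
def chainLaw (κ : S → PMF S) (x : S) : Measure (ℕ → S) :=
  (instructionLaw κ).map (traj x)

instance (κ : S → PMF S) (x : S) : IsProbabilityMeasure (chainLaw κ x) :=
  Measure.isProbabilityMeasure_map (measurable_traj x).aemeasurable

theorem chainLaw_initial (κ : S → PMF S) (x : S) (n : ℕ) (y : ℕ → S) :
    chainLaw κ x {f | ∀ k ≤ n, f k = y k} =
      PMF.pure x (y 0) * ∏ k ∈ Finset.range n, κ (y k) (y (k + 1)) := by
  classical
  rw [chainLaw, Measure.map_apply (measurable_traj x) (measurableSet_initial n y)]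
  by_cases hx : y 0 = x
  -- Instructions read along a path carry distinct times, so they are distinct coordinates of the
  -- product measure and their probabilities multiply.
  · have hinj : Set.InjOn (fun k : ℕ => (k, y k)) (Finset.range n : Set ℕ) :=
      fun a _ b _ h => (Prod.ext_iff.1 h).1
    have : traj x ⁻¹' {f | ∀ k ≤ n, f k = y k} =
        Set.pi ((Finset.range n).image fun k => (k, y k) : Finset (ℕ × S))
          (fun a => {y (a.1 + 1)}) := by
      ext u
      simp only [Set.mem_preimage, Set.mem_ofPred_eq, traj_eq_iff, hx, true_and]
      simp [Set.mem_pi]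
    rw [this, instructionLaw, Measure.infinitePi_pi _ fun a _ => measurableSet_singleton _,
      Finset.prod_image hinj, hx, PMF.pure_apply_self, one_mul]
    exact Finset.prod_congr rfl fun k _ =>
      PMF.toMeasure_apply_singleton _ _ (measurableSet_singleton _)
  · have : traj x ⁻¹' {f | ∀ k ≤ n, f k = y k} = ∅ := by
      ext u
      simp [traj_eq_iff, hx]
    rw [this, PMF.pure_apply_of_ne _ _ hx]
    simp

end Measurability

/-! ### Two-sided paths -/

/-- The transition matrix of the reversed chain. -/
def dualPMF (p : S → PMF S) (m : S → ℝ≥0) (hm : IsStationary p m) (x : S) : PMF S :=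
  ⟨dual p m x, by
    have hx : (m x : ℝ≥0∞) ≠ 0 := by simpa using (hm.1 x).ne'
    have : ∑' y, dual p m x y = 1 := by
      simp only [dual, ENNReal.div_eq_inv_mul, mul_assoc]
      rw [ENNReal.tsum_mul_left, hm.2 x, ENNReal.inv_mul_cancel hx ENNReal.coe_ne_top]
    exact this ▸ ENNReal.summable.hasSum⟩

@[simp] theorem dualPMF_apply (p : S → PMF S) (m : S → ℝ≥0) (hm : IsStationary p m) (x y : S) :
    dualPMF p m hm x y = dual p m x y := rfl

/-- The states at the times `0, -1, -2, …`. -/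
def past (ω : ℤ → S) : ℕ → S := fun n => ω (-(n : ℤ))

/-- The states at the times `0, 1, 2, …`. -/
def future (ω : ℤ → S) : ℕ → S := fun n => ω n

/-- The two-sided path with the given past and future. -/
def glue (f g : ℕ → S) : ℤ → S := fun n => if 0 ≤ n then g n.toNat else f (-n).toNat

theorem future_glue (f g : ℕ → S) : future (glue f g) = g := by
  ext n; simp [future, glue]

theorem past_glue (f g : ℕ → S) (h : f 0 = g 0) : past (glue f g) = f := by
  ext n
  rcases Nat.eq_zero_or_pos n with rfl | hn
  · simp [past, glue, h]
  · have : ¬ (0 : ℤ) ≤ -(n : ℤ) := by omega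
    simp [past, glue, hn.ne']

/-- The paths which agree with `x` at the times `-a, …, b`. -/
def cyl (a b : ℕ) (x : ℤ → S) : Set (ℤ → S) :=
  {ω | ∀ k : ℤ, -(a : ℤ) ≤ k → k ≤ (b : ℤ) → ω k = x k}

theorem cyl_eq (a b : ℕ) (x : ℤ → S) :
    cyl a b x = {ω | past ω ∈ {f | ∀ k ≤ a, f k = past x k} ∧
      future ω ∈ {f | ∀ k ≤ b, f k = future x k}} := by
  ext ω
  simp only [cyl, past, future, Set.mem_ofPred_eq]
  refine ⟨fun h => ⟨fun k hk => h _ (by omega) (by omega), fun k hk => h _ (by omega) (by omega)⟩,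
    fun h k h1 h2 => ?_⟩
  rcases le_total 0 k with h0 | h0
  · obtain ⟨n, rfl⟩ := Int.eq_ofNat_of_zero_le h0
    exact h.2 n (by omega)
  · obtain ⟨n, hn⟩ := Int.eq_ofNat_of_zero_le (neg_nonneg.2 h0)
    obtain rfl : k = -(n : ℤ) := by omega
    exact h.1 n (by omega)

theorem countable_range_cyl [Countable S] (a b : ℕ) : (Set.range (cyl (S := S) a b)).Countable := by
  classical
  rcases isEmpty_or_nonempty S with hS | ⟨⟨s⟩⟩
  · have : IsEmpty (ℤ → S) := ⟨fun f => hS.false (f 0)⟩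
    exact Set.countable_range _
  let ext : (Finset.Icc (-(a : ℤ)) b → S) → ℤ → S := fun y k => if h : k ∈ Finset.Icc (-(a : ℤ)) b
    then y ⟨k, h⟩ else s
  refine (Set.countable_range fun y => cyl a b (ext y)).mono ?_
  rintro _ ⟨x, rfl⟩
  refine ⟨fun k => x k, ?_⟩
  ext ω
  refine forall_congr' fun k => forall_congr' fun h1 => forall_congr' fun h2 => ?_
  simp [ext, h1, h2]

variable [MeasurableSpace S]

theorem measurable_past : Measurable (past : (ℤ → S) → ℕ → S) :=
  measurable_pi_lambda _ fun _ => measurable_pi_apply _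

theorem measurable_future : Measurable (future : (ℤ → S) → ℕ → S) :=
  measurable_pi_lambda _ fun _ => measurable_pi_apply _

theorem measurable_glue : Measurable fun q : (ℕ → S) × (ℕ → S) => glue q.1 q.2 := by
  refine measurable_pi_lambda _ fun n => ?_
  by_cases h : 0 ≤ n
  · simp only [glue, h, if_true]; fun_prop
  · simp only [glue, h, if_false]; fun_prop

variable [MeasurableSingletonClass S]

theorem measurableSet_cyl (a b : ℕ) (x : ℤ → S) : MeasurableSet (cyl a b x) := by
  rw [cyl_eq]
  exact (measurable_past (measurableSet_initial a _)).inter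
    (measurable_future (measurableSet_initial b _))

variable [Countable S]

/-- A measure on paths is determined by its values on large symmetric blocks. -/
theorem ext_of_cyl {μ μ' : Measure (ℤ → S)} (N : ℕ)
    (hfin : ∀ n x, N ≤ n → μ (cyl n n x) ≠ ∞)
    (h : ∀ n x, N ≤ n → μ (cyl n n x) = μ' (cyl n n x)) : μ = μ' := by
  -- Symmetric blocks are a π-system because two of them that meet are nested. Only countably many
  -- have a given window, and those with window `N` cover the space.
  refine Measure.ext_of_generateFrom_of_cover_subset
    (S := {s | ∃ n x, N ≤ n ∧ cyl n n x = s}) (T := Set.range (cyl N N)) ?_ ?_ ?_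
    (countable_range_cyl N N) ?_ ?_ ?_
  · refine le_antisymm ?_ (MeasurableSpace.generateFrom_le ?_)
    · refine iSup_le fun k => ?_
      rw [← measurable_iff_comap_le]
      refine @measurable_to_countable' _ _ _ _ (_) _ fun s => ?_
      have : (fun ω : ℤ → S => ω k) ⁻¹' {s} =
          ⋃ c ∈ {c ∈ Set.range (cyl (S := S) (N + k.natAbs) (N + k.natAbs)) |
            c ⊆ (fun ω : ℤ → S => ω k) ⁻¹' {s}}, c := by
        ext ω
        simp only [Set.mem_iUnion, exists_prop]
        refine ⟨fun hω => ⟨cyl (N + k.natAbs) (N + k.natAbs) ω, ⟨⟨ω, rfl⟩, fun ω' h' => ?_⟩,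
          fun _ _ _ => rfl⟩, fun ⟨c, hc, hω⟩ => hc.2 hω⟩
        have := h' k (by omega) (by omega)
        exact this.trans hω
      rw [this]
      refine MeasurableSet.biUnion ((countable_range_cyl _ _).mono fun c hc => hc.1) ?_
      rintro _ ⟨⟨x, rfl⟩, -⟩
      exact MeasurableSpace.measurableSet_generateFrom ⟨_, x, by omega, rfl⟩
    · rintro _ ⟨n, x, -, rfl⟩
      exact measurableSet_cyl n n x
  · rintro _ ⟨n, x, hn, rfl⟩ _ ⟨n', x', hn', rfl⟩ ⟨ω, hω, hω'⟩
    refine ⟨max n n', ω, by omega, ?_⟩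
    ext ω₁
    simp only [cyl, Set.mem_inter_iff, Set.mem_ofPred_eq] at *
    refine ⟨fun h1 => ⟨fun k hk hk' => ?_, fun k hk hk' => ?_⟩, fun h1 k hk hk' => ?_⟩
    · rw [h1 k (by omega) (by omega), hω k hk hk']
    · rw [h1 k (by omega) (by omega), hω' k hk hk']
    · rcases le_total n n' with h2 | h2
      · rw [h1.2 k (by omega) (by omega), hω' k (by omega) (by omega)]
      · rw [h1.1 k (by omega) (by omega), hω k (by omega) (by omega)]
  · rintro _ ⟨x, rfl⟩
    exact ⟨N, x, le_rfl, rfl⟩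
  · exact Set.eq_univ_of_forall fun ω => ⟨cyl N N ω, ⟨ω, rfl⟩, fun _ _ _ => rfl⟩
  · rintro _ ⟨x, rfl⟩
    exact hfin N x le_rfl
  · rintro _ ⟨n, x, hn, rfl⟩
    exact h n x hn

/-! ### The law of the two-sided chain -/

section PathLaw

variable (p : S → PMF S) (m : S → ℝ≥0) (hm : IsStationary p m)

/-- The law on path space of the two-sided chain started in `x`. -/
def pathLaw (x : S) : Measure (ℤ → S) :=
  ((instructionLaw (dualPMF p m hm)).prod (instructionLaw p)).map
    fun q => glue (traj x q.1) (traj x q.2)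

theorem measurable_glue_traj (x : S) :
    Measurable fun q : (ℕ × S → S) × (ℕ × S → S) => glue (traj x q.1) (traj x q.2) :=
  measurable_glue.comp (((measurable_traj x).comp measurable_fst).prodMk
    ((measurable_traj x).comp measurable_snd))

instance (x : S) : IsProbabilityMeasure (pathLaw p m hm x) :=
  Measure.isProbabilityMeasure_map (measurable_glue_traj x).aemeasurable

theorem pathLaw_past_future (x : S) {F G : Set (ℕ → S)} (hF : MeasurableSet F)
    (hG : MeasurableSet G) :
    pathLaw p m hm x {ω | past ω ∈ F ∧ future ω ∈ G} =
      chainLaw (dualPMF p m hm) x F * chainLaw p x G := by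
  have hs : MeasurableSet {ω : ℤ → S | past ω ∈ F ∧ future ω ∈ G} :=
    (measurable_past hF).inter (measurable_future hG)
  rw [pathLaw, Measure.map_apply (measurable_glue_traj x) hs, chainLaw, chainLaw,
    Measure.map_apply (measurable_traj x) hF, Measure.map_apply (measurable_traj x) hG,
    ← Measure.prod_prod]
  congr 1
  ext q
  simp [past_glue (traj x q.1) (traj x q.2) rfl, future_glue]

theorem pathLaw_past (x : S) {F : Set (ℕ → S)} (hF : MeasurableSet F) :
    pathLaw p m hm x {ω | past ω ∈ F} = chainLaw (dualPMF p m hm) x F := by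
  simpa using pathLaw_past_future p m hm x hF MeasurableSet.univ

theorem pathLaw_future (x : S) {G : Set (ℕ → S)} (hG : MeasurableSet G) :
    pathLaw p m hm x {ω | future ω ∈ G} = chainLaw p x G := by
  simpa using pathLaw_past_future p m hm x MeasurableSet.univ hG

/-- Given the present, the past and the future are independent. -/
theorem pathLaw_indep (x : S) {F G : Set (ℕ → S)} (hF : MeasurableSet F) (hG : MeasurableSet G) :
    pathLaw p m hm x {ω | past ω ∈ F ∧ future ω ∈ G} =
      pathLaw p m hm x {ω | past ω ∈ F} * pathLaw p m hm x {ω | future ω ∈ G} := by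
  rw [pathLaw_past_future p m hm x hF hG, pathLaw_past p m hm x hF, pathLaw_future p m hm x hG]

theorem pathLaw_cyl (z : S) (a b : ℕ) (x : ℤ → S) :
    pathLaw p m hm z (cyl a b x) =
      PMF.pure z (x 0) * (∏ k ∈ Finset.range b, p (x (k : ℤ)) (x ((k : ℤ) + 1)))
        * ∏ k ∈ Finset.range a, dual p m (x (-(k : ℤ))) (x (-(k : ℤ) - 1)) := by
  rw [cyl_eq, pathLaw_past_future p m hm z (measurableSet_initial _ _) (measurableSet_initial _ _),
    chainLaw_initial, chainLaw_initial]
  have h1 : past x 0 = x 0 := rfl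
  have h2 : future x 0 = x 0 := rfl
  have h3 : ∀ k : ℕ, past x (k + 1) = x (-(k : ℤ) - 1) := fun k => by
    simp only [past]; congr 1; push_cast; ring
  have h4 : ∀ k : ℕ, future x (k + 1) = x ((k : ℤ) + 1) := fun k => by
    simp [future]
  -- Past and future each contribute the initial factor; being 0 or 1, it is idempotent.
  have h5 : PMF.pure z (x 0) * PMF.pure z (x 0) = PMF.pure z (x 0) := by
    rw [PMF.pure_apply]; split_ifs <;> simp
  simp only [h1, h2, h3, h4, dualPMF_apply]
  simp only [past, future]
  rw [mul_mul_mul_comm, h5, mul_assoc, mul_comm (∏ k ∈ Finset.range a, _)]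

end PathLaw

end TwoSided
end

noncomputable section

namespace TwoSided

variable {S : Type*}

/-! ### The stationary measure on path space -/

/-- The path seen from time `n`. -/
def shift (n : ℤ) (ω : ℤ → S) : ℤ → S := fun k => ω (k + n)

@[simp] theorem shift_apply (n : ℤ) (ω : ℤ → S) (k : ℤ) : shift n ω k = ω (k + n) := rfl

theorem shift_shift (n k : ℤ) (ω : ℤ → S) : shift n (shift k ω) = shift (n + k) ω := by
  ext l; simp [add_assoc]

theorem shift_zero (ω : ℤ → S) : shift 0 ω = ω := by
  ext l; simp

theorem measurable_shift [MeasurableSpace S] (n : ℤ) : Measurable (shift (S := S) n) :=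
  measurable_pi_lambda _ fun _ => measurable_pi_apply _

theorem IsStationary.coe_ne_zero {p : S → PMF S} {m : S → ℝ≥0} (hm : IsStationary p m) (x : S) :
    (m x : ℝ≥0∞) ≠ 0 := by
  simpa using (hm.1 x).ne'

theorem mul_dual (p : S → PMF S) (m : S → ℝ≥0) (hm : IsStationary p m) (x y : S) :
    (m x : ℝ≥0∞) * dual p m x y = m y * p y x := by
  rw [dual, ← mul_assoc, ENNReal.mul_div_cancel (hm.coe_ne_zero x) ENNReal.coe_ne_top]

theorem tsum_indicator_one {ι : Type*} (s : Set ι) :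
    ∑' k, s.indicator (1 : ι → ℝ≥0∞) k = s.encard := by
  rw [← tsum_subtype]
  exact ENNReal.tsum_set_one s

theorem measurableSet_coord [MeasurableSpace S] [MeasurableSingletonClass S] {ι : Type*} (k : ι)
    (x : S) : MeasurableSet {f : ι → S | f k = x} :=
  (measurable_pi_apply k : Measurable fun f : ι → S => f k) (measurableSet_singleton x)

theorem measurableSet_firstHit [MeasurableSpace S] [MeasurableSingletonClass S] (n : ℕ) (y : S) :
    MeasurableSet {f : ℕ → S | f (n + 1) = y ∧ ∀ l < n, f (l + 1) ≠ y} := by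
  have : {f : ℕ → S | f (n + 1) = y ∧ ∀ l < n, f (l + 1) ≠ y} =
      {f | f (n + 1) = y} ∩ ⋂ l, ⋂ _ : l < n, {f | f (l + 1) = y}ᶜ := by
    ext f; simp
  rw [this]
  exact (measurableSet_coord _ y).inter (MeasurableSet.iInter fun l => MeasurableSet.iInter fun _ =>
    (measurableSet_coord _ y).compl)

theorem measure_eq_tsum_fiber [Countable S] [MeasurableSpace S] [MeasurableSingletonClass S]
    {Ω : Type*} [MeasurableSpace Ω] (μ : Measure Ω) {f : Ω → S} (hf : Measurable f)
    {A : Set Ω} (hA : MeasurableSet A) : μ A = ∑' z, μ {ω | f ω = z ∧ ω ∈ A} := by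
  rw [← measure_iUnion]
  · congr 1
    ext ω
    simp
  · exact fun a b hab => Set.disjoint_left.2 fun ω h1 h2 => hab (h1.1.symm.trans h2.1)
  · exact fun z => (hf (measurableSet_singleton z)).inter hA

section Stationary

variable [MeasurableSpace S] (p : S → PMF S) (m : S → ℝ≥0) (hm : IsStationary p m)

/-- The measure under which the path starts from the weights `w` and evolves as the two-sided
chain. -/
def mixLaw (w : S → ℝ≥0∞) : Measure (ℤ → S) :=
  Measure.sum fun x => w x • pathLaw p m hm x

theorem mixLaw_apply (w : S → ℝ≥0∞) {A : Set (ℤ → S)} (hA : MeasurableSet A) :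
    mixLaw p m hm w A = ∑' z, w z * pathLaw p m hm z A := by
  simp [mixLaw, Measure.sum_apply _ hA]

theorem mixLaw_pure (i : S) : mixLaw p m hm (PMF.pure i) = pathLaw p m hm i := by
  ext A hA
  rw [mixLaw_apply p m hm _ hA, tsum_eq_single i]
  · simp
  · intro j hj
    rw [PMF.pure_apply_of_ne _ _ hj, zero_mul]

/-- The law of the stationary two-sided chain; its total mass is that of `m`. -/
def statMeasure : Measure (ℤ → S) := mixLaw p m hm fun x => m x

variable [MeasurableSingletonClass S] [Countable S]

theorem pathLaw_ae_zero (z : S) : ∀ᵐ ω ∂pathLaw p m hm z, ω 0 = z := by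
  rw [pathLaw, ae_map_iff (measurable_glue_traj z).aemeasurable
    (measurableSet_coord 0 z)]
  exact Filter.Eventually.of_forall fun q => rfl

theorem mixLaw_state (w : S → ℝ≥0∞) (z : S) {A : Set (ℤ → S)} (hA : MeasurableSet A) :
    mixLaw p m hm w {ω | ω 0 = z ∧ ω ∈ A} = w z * pathLaw p m hm z A := by
  have hs : MeasurableSet {ω : ℤ → S | ω 0 = z ∧ ω ∈ A} :=
    (measurableSet_coord 0 z).inter hA
  rw [mixLaw_apply p m hm w hs, tsum_eq_single z]
  · congr 1
    refine measure_congr ?_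
    filter_upwards [pathLaw_ae_zero p m hm z] with ω hω
    exact propext (and_iff_right hω)
  · intro y hy
    have : pathLaw p m hm y {ω | ω 0 = z ∧ ω ∈ A} = 0 := by
      refine measure_mono_null ?_ (ae_iff.1 (pathLaw_ae_zero p m hm y))
      exact fun ω hω h => hy (h.symm.trans hω.1)
    rw [this, mul_zero]

theorem statMeasure_state (z : S) {A : Set (ℤ → S)} (hA : MeasurableSet A) :
    statMeasure p m hm {ω | ω 0 = z ∧ ω ∈ A} = m z * pathLaw p m hm z A :=
  mixLaw_state p m hm _ z hA

theorem mixLaw_cyl (w : S → ℝ≥0∞) (a b : ℕ) (x : ℤ → S) :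
    mixLaw p m hm w (cyl a b x) =
      w (x 0) * (∏ k ∈ Finset.range b, p (x (k : ℤ)) (x ((k : ℤ) + 1)))
        * ∏ k ∈ Finset.range a, dual p m (x (-(k : ℤ))) (x (-(k : ℤ) - 1)) := by
  rw [mixLaw_apply p m hm w (measurableSet_cyl _ _ _), tsum_eq_single (x 0)]
  · rw [pathLaw_cyl, PMF.pure_apply_self, one_mul, mul_assoc]
  · intro z hz
    rw [pathLaw_cyl, PMF.pure_apply_of_ne _ _ hz.symm]
    simp

/-- By `mul_dual`, each backward step moves the weight `m` one time unit to the left. The resulting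
formula depends only on the sequence of states in the block and not on where time 0 lies, which
gives shift invariance. -/
theorem statMeasure_cyl (a b : ℕ) (x : ℤ → S) :
    statMeasure p m hm (cyl a b x) = m (x (-a)) *
      ∏ k ∈ Finset.range (a + b), p (x (-a + k)) (x (-a + k + 1)) := by
  rw [statMeasure, mixLaw_cyl]
  induction a with
  | zero => simp
  | succ a ih =>
    rw [Finset.prod_range_succ, ← mul_assoc, ih,
      mul_right_comm, mul_dual p m hm, show a + 1 + b = a + b + 1 by ring, Finset.prod_range_succ',
      mul_assoc, mul_comm (p _ _)]
    congr 1
    · push_cast; ring_nf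
    congr 1
    · refine Finset.prod_congr rfl fun k _ => ?_
      congr 2 <;> (push_cast; ring_nf)
    · push_cast; ring_nf

/-- Windows of radius at least `n.natAbs` still contain time 0 after the shift, so shifted blocks
are again of the form `cyl a b`. -/
theorem measurePreserving_shift (n : ℤ) :
    MeasurePreserving (shift n) (statMeasure p m hm) (statMeasure p m hm) := by
  refine ⟨measurable_shift n, Eq.symm (ext_of_cyl n.natAbs (fun N x _ => ?_) fun N x hN => ?_)⟩
  · rw [statMeasure_cyl]
    exact ENNReal.mul_ne_top ENNReal.coe_ne_top
      (ENNReal.prod_ne_top fun k _ => PMF.apply_ne_top _ _)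
  · rw [Measure.map_apply (measurable_shift n) (measurableSet_cyl _ _ _)]
    obtain ⟨a, ha⟩ := Int.eq_ofNat_of_zero_le (show 0 ≤ N - n by omega)
    obtain ⟨b, hb⟩ := Int.eq_ofNat_of_zero_le (show 0 ≤ N + n by omega)
    have : shift n ⁻¹' cyl N N x = cyl a b (shift (-n) x) := by
      ext ω
      simp only [cyl, Set.mem_preimage, Set.mem_ofPred_eq, shift_apply]
      refine ⟨fun h k h1 h2 => ?_, fun h k h1 h2 => ?_⟩
      · simpa using h (k + -n) (by omega) (by omega)
      · simpa using h (k + n) (by omega) (by omega)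
    rw [this, statMeasure_cyl, statMeasure_cyl, show a + b = N + N by omega]
    simp only [shift_apply]
    have e : ∀ k : ℤ, -(a : ℤ) + k + -n = -(N : ℤ) + k := fun k => by omega
    have e' : ∀ k : ℤ, -(a : ℤ) + k + 1 + -n = -(N : ℤ) + k + 1 := fun k => by omega
    have e'' : -(a : ℤ) + -n = -(N : ℤ) := by omega
    simp only [e, e', e'']

theorem statMeasure_preimage_shift (n : ℤ) {A : Set (ℤ → S)} (hA : MeasurableSet A) :
    statMeasure p m hm {ω | shift n ω ∈ A} = statMeasure p m hm A :=
  (measurePreserving_shift p m hm n).measure_preimage hA.nullMeasurableSet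

/-! ### Markov property, recurrence and conservativity of the shift -/

include hm in
/-- The Markov property at time one. -/
theorem chainLaw_step (y : S) (Z : Set S) {G : Set (ℕ → S)} (hG : MeasurableSet G) :
    chainLaw p y {f | f 1 ∈ Z ∧ (fun n => f (n + 1)) ∈ G} =
      ∑' z, Z.indicator (fun z => p y z * chainLaw p z G) z := by
  have htail : Measurable fun (f : ℕ → S) (n : ℕ) => f (n + 1) :=
    measurable_pi_lambda _ fun _ => measurable_pi_apply _
  have hZ : MeasurableSet {f : ℕ → S | f 1 ∈ Z} := measurable_pi_apply 1 (MeasurableSet.of_discrete)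
  have hZG : MeasurableSet {f : ℕ → S | f 1 ∈ Z ∧ (fun n => f (n + 1)) ∈ G} :=
    hZ.inter (htail hG)
  rw [measure_eq_tsum_fiber _ (measurable_pi_apply 1) hZG]
  refine tsum_congr fun z => ?_
  by_cases hz : z ∈ Z
  swap
  · rw [Set.indicator_of_notMem hz]
    convert measure_empty (μ := chainLaw p y)
    ext f
    simp only [Set.mem_ofPred_eq, Set.mem_empty_iff_false, iff_false]
    rintro ⟨rfl, h, -⟩
    exact hz h
  rw [Set.indicator_of_mem hz]
  have hset : {f : ℕ → S | f 1 = z ∧ f ∈ {f : ℕ → S | f 1 ∈ Z ∧ (fun n => f (n + 1)) ∈ G}} =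
      {f : ℕ → S | f 1 = z ∧ (fun n => f (n + 1)) ∈ G} := by
    ext f
    simp only [Set.mem_ofPred_eq]
    exact ⟨fun h => ⟨h.1, h.2.2⟩, fun h => ⟨h.1, h.1 ▸ hz, h.2⟩⟩
  rw [hset]
  have hG' : MeasurableSet {f : ℕ → S | f 1 = z ∧ (fun n => f (n + 1)) ∈ G} :=
    (measurableSet_coord 1 z).inter (htail hG)
  have hy : MeasurableSet {f : ℕ → S | f 1 = y} := measurableSet_coord 1 y
  have hGω : MeasurableSet {ω : ℤ → S | future ω ∈ {f : ℕ → S | f 1 = z ∧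
      (fun n => f (n + 1)) ∈ G}} := measurable_future hG'
  have hyG : MeasurableSet {ω : ℤ → S | past ω ∈ {f : ℕ → S | f 1 = y} ∧ future ω ∈ G} :=
    (measurable_past hy).inter (measurable_future hG)
  have hyω : MeasurableSet {ω : ℤ → S | past ω ∈ {f : ℕ → S | f 1 = y}} := measurable_past hy
  -- After multiplication by `m y` the claim concerns the stationary measure. Shifting by one puts
  -- `z` at time 0, where the event of coming from `y` belongs to the past and `G` to the future,
  -- and these are independent.
  rw [← ENNReal.mul_right_inj (hm.coe_ne_zero y) ENNReal.coe_ne_top,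
    ← pathLaw_future p m hm y hG', ← statMeasure_state p m hm y hGω]
  have h1 : MeasurableSet {ω : ℤ → S | ω 0 = z ∧ ω ∈ {ω | past ω ∈ {f | f 1 = y} ∧
      future ω ∈ G}} :=
    (measurableSet_coord 0 z).inter hyG
  have h2 : {ω : ℤ → S | ω 0 = y ∧ ω ∈ {ω : ℤ → S | future ω ∈ {f : ℕ → S | f 1 = z ∧
      (fun n => f (n + 1)) ∈ G}}} =
      {ω | shift 1 ω ∈ {ω : ℤ → S | ω 0 = z ∧ ω ∈ {ω | past ω ∈ {f | f 1 = y} ∧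
        future ω ∈ G}}} := by
    ext ω
    have h3 : future (shift 1 ω) = fun n => future ω (n + 1) := by ext n; simp [future]
    simp only [Set.mem_ofPred_eq, h3]
    simp only [future, past, shift_apply]
    norm_num
    tauto
  have h3 : (m z : ℝ≥0∞) * pathLaw p m hm z {ω | past ω ∈ {f | f 1 = y}} = m y * p y z := by
    rw [← statMeasure_state p m hm z hyω]
    have := statMeasure_cyl p m hm 1 0 (fun k => if k = 0 then z else y)
    simp only [Nat.cast_one, Int.reduceNeg, neg_eq_zero, one_ne_zero, if_false, add_zero,
      Finset.range_one, Finset.prod_singleton, Nat.cast_zero, neg_add_cancel, if_true] at this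
    rw [← this]
    congr 1
    ext ω
    simp only [Set.mem_ofPred_eq, past, cyl]
    refine ⟨fun h k hk hk' => ?_, fun h => ?_⟩
    · obtain rfl | rfl : k = 0 ∨ k = -1 := by push_cast at hk hk'; omega
      · simpa using h.1
      · simpa using h.2
    · have h0 := h 0 (by simp) (by simp)
      have h1 := h (-1) (by simp) (by simp)
      simp_all
  rw [h2, statMeasure_preimage_shift p m hm 1 h1,
    statMeasure_state p m hm z hyG,
    pathLaw_indep p m hm z hy hG, ← mul_assoc, h3, pathLaw_future p m hm z hG, mul_assoc]

theorem chainLaw_ae_zero (z : S) : ∀ᵐ f ∂chainLaw p z, f 0 = z := by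
  rw [chainLaw, ae_map_iff (measurable_traj z).aemeasurable
    (measurableSet_coord 0 z)]
  exact Filter.Eventually.of_forall fun q => rfl

include hm in
/-- The Markov property at time `n`. -/
theorem chainLaw_markov (n : ℕ) (x y : S) {G : Set (ℕ → S)} (hG : MeasurableSet G) :
    chainLaw p x {f | f n = y ∧ (fun l => f (l + n)) ∈ G} = stepDist p n x y * chainLaw p y G := by
  induction n generalizing x with
  | zero =>
    by_cases h : y = x
    · subst h
      rw [stepDist, PMF.pure_apply_self, one_mul]
      refine measure_congr ?_
      filter_upwards [chainLaw_ae_zero p y] with f hf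
      exact propext (and_iff_right hf)
    · rw [stepDist, PMF.pure_apply_of_ne _ _ h, zero_mul]
      refine measure_mono_null ?_ (ae_iff.1 (chainLaw_ae_zero p x))
      exact fun f hf h' => h (hf.1.symm.trans h')
  | succ n ih =>
    have htail : Measurable fun (f : ℕ → S) (l : ℕ) => f (l + n) :=
      measurable_pi_lambda _ fun _ => measurable_pi_apply _
    have hset : MeasurableSet {f : ℕ → S | f n = y ∧ (fun l => f (l + n)) ∈ G} :=
      (measurableSet_coord n y).inter (htail hG)
    have := chainLaw_step p m hm x Set.univ hset
    simp only [Set.mem_univ, true_and, Set.indicator_univ] at this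
    rw [stepDist, PMF.bind_apply, ← ENNReal.tsum_mul_right]
    simp_rw [mul_assoc, ← ih]
    exact this

include hm in
theorem chainLaw_eq_firstHitProb (n : ℕ) (x y : S) :
    chainLaw p x {f | f (n + 1) = y ∧ ∀ l < n, f (l + 1) ≠ y} = firstHitProb p y n x := by
  induction n generalizing x with
  | zero =>
    have := chainLaw_step p m hm x {y} MeasurableSet.univ
    rw [tsum_eq_single y fun z hz => Set.indicator_of_notMem (s := {y}) (by simpa using hz) _] at this
    simpa [firstHitProb] using this
  | succ n ih =>
    have := chainLaw_step p m hm x {z | z ≠ y} (measurableSet_firstHit n y)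
    rw [← tsum_subtype] at this
    simp_rw [ih] at this
    rw [firstHitProb]
    refine Eq.trans ?_ this
    congr 1
    ext f
    simp only [Set.mem_ofPred_eq]
    constructor
    · exact fun h => ⟨h.2 0 (by omega), h.1, fun l hl => h.2 (l + 1) (by omega)⟩
    · refine fun h => ⟨h.2.1, fun l hl => ?_⟩
      rcases l with _ | l
      · exact h.1
      · exact h.2.2 l (by omega)

include hm in
theorem chainLaw_ae_return (hrec : IsRecurrent p) (x : S) :
    ∀ᵐ f ∂chainLaw p x, ∃ n : ℕ, f (n + 1) = x := by
  classical
  have h1 : chainLaw p x (⋃ n, {f : ℕ → S | f (n + 1) = x ∧ ∀ l < n, f (l + 1) ≠ x}) = 1 := by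
    rw [measure_iUnion _ fun n => measurableSet_firstHit n x]
    · simp_rw [chainLaw_eq_firstHitProb p m hm]
      exact hrec x
    · intro a b hab
      refine Set.disjoint_left.2 fun f h1 h2 => ?_
      rcases lt_or_gt_of_ne hab with h | h
      · exact h2.2 a h h1.1
      · exact h1.2 b h h2.1
  have h2 := (prob_compl_eq_zero_iff (MeasurableSet.iUnion fun n => measurableSet_firstHit n x)).2 h1
  refine measure_mono_null ?_ h2
  intro f hf hf'
  obtain ⟨n, hn⟩ := Set.mem_iUnion.1 hf'
  exact hf ⟨n, hn.1⟩

theorem statMeasure_ae_infinite (hrec : IsRecurrent p) (x : S) :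
    ∀ᵐ ω ∂statMeasure p m hm, ω 0 = x → {n : ℕ | ω n = x}.Infinite := by
  have hret : MeasurableSet {f : ℕ → S | ¬ ∃ n : ℕ, f (n + 1) = x} := by
    simp only [not_exists, Set.ofPred_forall]
    exact MeasurableSet.iInter fun l =>
      (measurableSet_coord (l + 1) x).compl
  have hret' : MeasurableSet {ω : ℤ → S | future ω ∈ {f : ℕ → S | ¬ ∃ n : ℕ, f (n + 1) = x}} :=
    measurable_future hret
  have hR : MeasurableSet {ω : ℤ → S | ω 0 = x ∧ ω ∈ {ω | future ω ∈
      {f : ℕ → S | ¬ ∃ n : ℕ, f (n + 1) = x}}} :=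
    (measurableSet_coord 0 x).inter hret'
  have h0 : ∀ k : ℕ, ∀ᵐ ω ∂statMeasure p m hm, ¬ (shift k ω ∈ {ω : ℤ → S | ω 0 = x ∧
      ω ∈ {ω | future ω ∈ {f : ℕ → S | ¬ ∃ n : ℕ, f (n + 1) = x}}}) := by
    intro k
    rw [ae_iff]
    simp only [not_not]
    rw [statMeasure_preimage_shift p m hm k hR,
      statMeasure_state p m hm x hret', pathLaw_future p m hm x hret,
      ae_iff.1 (chainLaw_ae_return p m hm hrec x), mul_zero]
  filter_upwards [ae_all_iff.2 h0] with ω hω h0 hfin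
  -- Seen from a last visit, the path starts in `x` and never returns; this is null at every fixed
  -- time `k` by invariance.
  obtain ⟨k, hk, hmax⟩ := hfin.exists_maximal ⟨0, by simpa using h0⟩
  refine hω k ⟨by simpa using hk, ?_⟩
  rintro ⟨n, hn⟩
  have : k + n + 1 ∈ {n : ℕ | ω n = x} := by
    simp only [future, shift_apply] at hn
    rw [Set.mem_ofPred_eq, ← hn]
    congr 1; push_cast; ring
  have := hmax this (by omega)
  omega

/-- The shift is conservative: a set of paths with bounded return times is negligible. -/
theorem statMeasure_eq_zero_of_bounded_return (hrec : IsRecurrent p) (x : S) (n : ℕ)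
    {E : Set (ℤ → S)} (hE : MeasurableSet E) (hx : ∀ ω ∈ E, ω 0 = x)
    (hret : ∀ ω ∈ E, ∀ s : ℤ, n < s → shift s ω ∉ E) : statMeasure p m hm E = 0 := by
  by_contra hne
  set Q := statMeasure p m hm
  have hst : ∀ k : ℤ, MeasurableSet {ω : ℤ → S | ω k = x} := fun k =>
    measurableSet_coord k x
  -- The same sum is evaluated twice. Here it is the integral over `E` of the number of visits to
  -- `x`, which is infinite on `E` by recurrence.
  have h1 : ∑' k : ℕ, Q ({ω | ω k = x} ∩ E) = ∞ := by
    have : ∀ k : ℕ, Q ({ω | ω k = x} ∩ E) =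
        ∫⁻ ω in E, {ω : ℤ → S | ω k = x}.indicator 1 ω ∂Q := fun k => by
      rw [lintegral_indicator_one (hst k), Measure.restrict_apply (hst k)]
    simp_rw [this]
    rw [← lintegral_tsum fun k : ℕ => (measurable_one.indicator (hst k)).aemeasurable]
    have : ∫⁻ ω in E, ∑' k : ℕ, {ω : ℤ → S | ω k = x}.indicator (1 : (ℤ → S) → ℝ≥0∞) ω ∂Q =
        ∫⁻ ω in E, ∞ ∂Q := by
      refine setLIntegral_congr_fun_ae hE ?_
      filter_upwards [statMeasure_ae_infinite p m hm hrec x] with ω hω hωE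
      have h2 := tsum_indicator_one {n : ℕ | ω n = x}
      rw [(hω (hx ω hωE)).encard_eq, ENat.toENNReal_top] at h2
      exact h2
    rw [this, setLIntegral_const, ENNReal.top_mul hne]
  have hEk : ∀ k : ℕ, MeasurableSet {ω : ℤ → S | shift (-k) ω ∈ E} := fun k =>
    measurable_shift _ hE
  have h2 : ∀ k : ℕ, Q ({ω | ω k = x} ∩ E) =
      ∫⁻ ω in {ω | ω 0 = x}, {ω : ℤ → S | shift (-k) ω ∈ E}.indicator 1 ω ∂Q := fun k => by
    rw [lintegral_indicator_one (hEk k), Measure.restrict_apply (hEk k),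
      ← statMeasure_preimage_shift p m hm k ((hEk k).inter (hst 0))]
    congr 1
    ext ω
    simp [shift_shift, shift_zero, and_comm]
  -- Seen from the visit to `x`, the sum counts the `k` for which `E` occurred `k` steps ago. The
  -- smallest such `k` is the most recent occurrence, and bounded returns confine all others to a
  -- window of `n + 1` values.
  have h3 : ∑' k : ℕ, Q ({ω | ω k = x} ∩ E) ≤ (n + 1) * m x := by
    simp_rw [h2]
    rw [← lintegral_tsum fun k : ℕ => (measurable_one.indicator (hEk k)).aemeasurable]
    have hm0 : Q {ω | ω 0 = x} = m x := by
      simpa using statMeasure_state p m hm x MeasurableSet.univ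
    rw [← hm0, ← setLIntegral_const]
    refine lintegral_mono fun ω => ?_
    have h4 := tsum_indicator_one {k : ℕ | shift (-k) ω ∈ E}
    refine le_trans (le_of_eq h4) ?_
    rcases {k : ℕ | shift (-k) ω ∈ E}.eq_empty_or_nonempty with h5 | h5
    · simp [h5]
    have h6 : {k : ℕ | shift (-k) ω ∈ E} ⊆
        Finset.Icc (sInf {k : ℕ | shift (-k) ω ∈ E}) (sInf {k : ℕ | shift (-k) ω ∈ E} + n) := by
      intro k hk
      rw [Finset.coe_Icc]
      refine ⟨Nat.sInf_le hk, ?_⟩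
      by_contra hlt
      refine hret _ hk (k - (sInf {k : ℕ | shift (-k) ω ∈ E} : ℕ)) (by omega) ?_
      rw [shift_shift]
      have := Nat.sInf_mem h5
      simp only [Set.mem_ofPred_eq] at this
      convert this using 2
      ring
    have h7 := Set.encard_le_encard h6
    rw [Set.encard_coe_eq_coe_finsetCard, Nat.card_Icc] at h7
    calc (({k : ℕ | shift (-k) ω ∈ E}.encard : ℕ∞) : ℝ≥0∞)
        ≤ (((n + 1 : ℕ) : ℕ∞) : ℝ≥0∞) := by
          refine ENat.toENNReal_le.2 (h7.trans ?_)
          exact_mod_cast (by omega)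
      _ = n + 1 := by simp
  rw [h1] at h3
  exact absurd h3 (not_le.2 (ENNReal.mul_lt_top (by simp [ENNReal.add_lt_top])
    ENNReal.coe_lt_top))

end Stationary

end TwoSided
end

noncomputable section

namespace TwoSided

variable {S : Type*}

/-! ### Mass transport -/

/-- The path seen from the random time `τ`. -/
def jump (τ : (ℤ → S) → WithTop ℤ) (ω : ℤ → S) : ℤ → S := shift ((τ ω).untopD 0) ω

/-- The set of `k` such that the path is in state `i` at time `-k` and the random time started there
points to time `0`. -/
def sources (i : S) (τ : (ℤ → S) → WithTop ℤ) (ω : ℤ → S) : Set ℤ :=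
  {k | ω (-k) = i ∧ τ (shift (-k) ω) = k}

/-- The number of visits to `i` which are sent to time `0` by the random time `τ`. -/
def intake (i : S) (τ : (ℤ → S) → WithTop ℤ) (ω : ℤ → S) : ℝ≥0∞ := (sources i τ ω).encard

theorem intake_eq_tsum (i : S) (τ : (ℤ → S) → WithTop ℤ) (ω : ℤ → S) :
    intake i τ ω = ∑' k, {ω | k ∈ sources i τ ω}.indicator 1 ω :=
  (tsum_indicator_one (sources i τ ω)).symm

variable [MeasurableSpace S]

theorem measurable_jump {τ : (ℤ → S) → WithTop ℤ} (hτ : Measurable τ) : Measurable (jump τ) := by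
  have h : Measurable fun q : (ℤ → S) × ℤ => shift q.2 q.1 :=
    measurable_from_prod_countable_left fun n => measurable_shift n
  exact h.comp (measurable_id.prodMk (hτ.untopD 0))

variable [MeasurableSingletonClass S]

theorem measurableSet_mem_sources (i : S) {τ : (ℤ → S) → WithTop ℤ} (hτ : Measurable τ) (k : ℤ) :
    MeasurableSet {ω | k ∈ sources i τ ω} :=
  (measurableSet_coord (-k) i).inter
    ((hτ.comp (measurable_shift (-k))) (measurableSet_singleton (k : WithTop ℤ)))

theorem measurable_intake (i : S) {τ : (ℤ → S) → WithTop ℤ} (hτ : Measurable τ) :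
    Measurable (intake i τ) := by
  have : intake i τ = fun ω => ∑' k, {ω | k ∈ sources i τ ω}.indicator 1 ω :=
    funext (intake_eq_tsum i τ)
  rw [this]
  exact Measurable.tsum fun k => measurable_one.indicator (measurableSet_mem_sources i hτ k)

section

variable (p : S → PMF S) (m : S → ℝ≥0) (hm : IsStationary p m) [Countable S]

/-- Split according to the value `k` of `τ` and shift the `k`-th event by `k`: it becomes the event
that `k` is a source, intersected with `A`. The condition `τ ω ≠ ⊤` excludes paths where `jump`
stays put by default. -/
theorem transport (i : S) {τ : (ℤ → S) → WithTop ℤ} (hτ : Measurable τ) {A : Set (ℤ → S)}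
    (hA : MeasurableSet A) :
    m i * pathLaw p m hm i {ω | τ ω ≠ ⊤ ∧ jump τ ω ∈ A} =
      ∫⁻ ω in A, intake i τ ω ∂statMeasure p m hm := by
  have hmeas : MeasurableSet {ω | τ ω ≠ ⊤ ∧ jump τ ω ∈ A} :=
    (hτ (measurableSet_singleton (⊤ : WithTop ℤ))).compl.inter (measurable_jump hτ hA)
  have hk : ∀ k : ℤ, MeasurableSet {ω : ℤ → S | ω 0 = i ∧ τ ω = k ∧ shift k ω ∈ A} := fun k =>
    (measurableSet_coord 0 i).inter ((hτ (measurableSet_singleton (k : WithTop ℤ))).inter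
      (measurable_shift k hA))
  have hunion : {ω : ℤ → S | ω 0 = i ∧ ω ∈ {ω | τ ω ≠ ⊤ ∧ jump τ ω ∈ A}} =
      ⋃ k : ℤ, {ω : ℤ → S | ω 0 = i ∧ τ ω = k ∧ shift k ω ∈ A} := by
    ext ω
    simp only [Set.mem_ofPred_eq, Set.mem_iUnion, jump]
    constructor
    · rintro ⟨h0, h1, h2⟩
      obtain ⟨k, hk⟩ := WithTop.ne_top_iff_exists.1 h1
      rw [← hk] at h2
      exact ⟨k, h0, hk.symm, h2⟩
    · rintro ⟨k, h0, h1, h2⟩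
      rw [h1]
      exact ⟨h0, WithTop.coe_ne_top, h2⟩
  rw [← statMeasure_state p m hm i hmeas, hunion, measure_iUnion _ hk]
  · simp_rw [intake_eq_tsum]
    rw [lintegral_tsum fun k =>
      (measurable_one.indicator (measurableSet_mem_sources i hτ k)).aemeasurable]
    refine tsum_congr fun k => ?_
    have hs := measurableSet_mem_sources i hτ k
    rw [lintegral_indicator_one hs, Measure.restrict_apply hs,
      ← statMeasure_preimage_shift p m hm k (hs.inter hA)]
    congr 1
    ext ω
    simp [sources, shift_shift, shift_zero, and_assoc]
  · intro a b hab
    refine Set.disjoint_left.2 fun ω h1 h2 => hab ?_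
    exact WithTop.coe_injective (h1.2.1.symm.trans h2.2.1)

theorem statMeasure_restrict (j : S) :
    (statMeasure p m hm).restrict {ω | ω 0 = j} = (m j : ℝ≥0∞) • pathLaw p m hm j := by
  ext A hA
  rw [Measure.restrict_apply hA, Measure.smul_apply, smul_eq_mul, ← statMeasure_state p m hm j hA,
    Set.inter_comm]
  rfl

theorem isTwoSidedChain_iff {Ω : Type*} [MeasurableSpace Ω] (P : Measure Ω) [IsFiniteMeasure P]
    (ν : PMF S) (X : ℤ → Ω → S) (hX : ∀ n, Measurable (X n)) :
    IsTwoSidedChain p m ν P X ↔ P.map (fun ω n => X n ω) = mixLaw p m hm ν := by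
  have hmeas : Measurable fun ω n => X n ω := measurable_pi_lambda _ hX
  have hcyl : ∀ (a b : ℕ) (x : ℤ → S), P.map (fun ω n => X n ω) (cyl a b x) =
      P {ω | ∀ k : ℤ, -(a : ℤ) ≤ k → k ≤ (b : ℤ) → X k ω = x k} := fun a b x =>
    Measure.map_apply hmeas (measurableSet_cyl a b x)
  constructor
  · refine fun h => ext_of_cyl 0 (fun n x _ => measure_ne_top _ _) fun n x _ => ?_
    rw [hcyl, h.prob_block, mixLaw_cyl]
  · refine fun h => ⟨hX, fun a b x => ?_⟩
    rw [← hcyl, h, mixLaw_cyl]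

/-- If the path seen from `τ` is a two-sided chain with initial distribution `ν`, then almost every
path from `j` has intake `m i * ν j / m j`, so that this is an integer. -/
theorem exists_nat_of_map_jump_eq (i : S) (ν : PMF S) {τ : (ℤ → S) → WithTop ℤ}
    (hτ : Measurable τ) (hfin : ∀ᵐ ω ∂pathLaw p m hm i, τ ω ≠ ⊤)
    (hmap : (pathLaw p m hm i).map (jump τ) = mixLaw p m hm ν) (j : S) :
    ∃ n : ℕ, (m i : ℝ≥0∞) * ν j = n * m j := by
  have hj := hm.coe_ne_zero j
  have hc : (m i : ℝ≥0∞) * ν j / m j ≠ ∞ :=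
    ENNReal.div_ne_top (ENNReal.mul_ne_top ENNReal.coe_ne_top (PMF.apply_ne_top _ _)) hj
  have hint : ∀ C, MeasurableSet C → ∫⁻ ω in C, intake i τ ω ∂pathLaw p m hm j =
      ∫⁻ _ in C, (m i : ℝ≥0∞) * ν j / m j ∂pathLaw p m hm j := by
    intro C hC
    have hs : MeasurableSet {ω : ℤ → S | ω 0 = j ∧ ω ∈ C} := (measurableSet_coord 0 j).inter hC
    have h1 := transport p m hm i hτ hs
    have h2 : pathLaw p m hm i {ω | τ ω ≠ ⊤ ∧ jump τ ω ∈ {ω : ℤ → S | ω 0 = j ∧ ω ∈ C}} =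
        ν j * pathLaw p m hm j C := by
      rw [← mixLaw_state p m hm ν j hC, ← hmap, Measure.map_apply (measurable_jump hτ) hs]
      refine measure_congr ?_
      filter_upwards [hfin] with ω hω
      exact propext (and_iff_right hω)
    have h3 : (statMeasure p m hm).restrict {ω : ℤ → S | ω 0 = j ∧ ω ∈ C} =
        (m j : ℝ≥0∞) • (pathLaw p m hm j).restrict C := by
      rw [← Measure.restrict_smul, ← statMeasure_restrict, Measure.restrict_restrict hC,
        Set.inter_comm]
      rfl
    rw [h2, h3, lintegral_smul_measure, smul_eq_mul] at h1
    rw [setLIntegral_const, ← ENNReal.mul_right_inj hj ENNReal.coe_ne_top, ← h1, ← mul_assoc,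
      ← mul_assoc, ENNReal.mul_div_cancel hj ENNReal.coe_ne_top]
  -- The integrals agree on every measurable set, so the intake is almost surely constant; one path
  -- with this value suffices below.
  have hae : intake i τ =ᵐ[pathLaw p m hm j] fun _ => (m i : ℝ≥0∞) * ν j / m j :=
    ae_eq_of_forall_setLIntegral_eq_of_sigmaFinite (measurable_intake i hτ) measurable_const
      fun C hC _ => hint C hC
  obtain ⟨ω, hω⟩ := hae.exists
  have hfin : (sources i τ ω).encard ≠ ⊤ := by
    intro h
    rw [intake, h] at hω
    exact hc (by simpa using hω.symm)
  obtain ⟨n, hn⟩ := ENat.ne_top_iff_exists.1 hfin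
  refine ⟨n, ?_⟩
  rw [intake, ← hn, ENat.toENNReal_coe] at hω
  rw [hω, ENNReal.div_mul_cancel hj ENNReal.coe_ne_top]

end

end TwoSided
end

noncomputable section

namespace TwoSided

variable {S : Type*}

/-! ### The matching of visits to `i` with demands `k` -/

section Matching

open scoped Classical in
/-- Each visit to `i` supplies one unit, each visit to `x` demands `k x` units. -/
def charge (i : S) (k : S → ℕ) (x : S) : ℤ := (if x = i then 1 else 0) - k x

variable (i : S) (k : S → ℕ)

/-- The net supply at the times `0, …, n`. -/
def balance (f : ℕ → S) (n : ℕ) : ℤ := ∑ l ∈ Finset.range (n + 1), charge i k (f l)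

open scoped Classical in
/-- The first time `n ≥ 0` at which the supply at the times `0, …, n` is used up when demands are
served by the most recent supply. -/
def matchTime (ω : ℤ → S) : WithTop ℤ :=
  if h : ∃ n, balance i k (future ω) n ≤ 0 then ((Nat.find h : ℤ) : WithTop ℤ) else ⊤

theorem matchTime_eq_top_iff (ω : ℤ → S) :
    matchTime i k ω = ⊤ ↔ ∀ n, 0 < balance i k (future ω) n := by
  rw [matchTime]
  split_ifs with h
  · simpa using h
  · simpa using h

theorem matchTime_le_iff (ω : ℤ → S) (a : ℤ) :
    matchTime i k ω ≤ a ↔ ∃ n : ℕ, (n : ℤ) ≤ a ∧ balance i k (future ω) n ≤ 0 := by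
  classical
  rw [matchTime]
  split_ifs with h
  · rw [WithTop.coe_le_coe]
    refine ⟨fun h' => ⟨Nat.find h, h', Nat.find_spec h⟩, fun ⟨n, hn, hn'⟩ => ?_⟩
    have := Nat.find_min' h hn'
    omega
  · simp only [WithTop.top_le_iff, WithTop.coe_ne_top, false_iff]
    exact fun ⟨n, _, hn⟩ => h ⟨n, hn⟩

theorem matchTime_eq_coe_iff (ω : ℤ → S) (a : ℤ) :
    matchTime i k ω = a ↔ ∃ n : ℕ, a = n ∧ balance i k (future ω) n ≤ 0 ∧
      ∀ l < n, 0 < balance i k (future ω) l := by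
  classical
  rw [matchTime]
  split_ifs with h
  · rw [WithTop.coe_inj]
    constructor
    · rintro rfl
      exact ⟨_, rfl, Nat.find_spec h, fun l hl => not_le.1 (Nat.find_min h hl)⟩
    · rintro ⟨n, rfl, h1, h2⟩
      rw [Nat.cast_inj, Nat.find_eq_iff]
      exact ⟨h1, fun l hl => not_le.2 (h2 l hl)⟩
  · simp only [WithTop.top_ne_coe, false_iff]
    exact fun ⟨n, _, hn, _⟩ => h ⟨n, hn⟩

theorem matchTime_nonneg (ω : ℤ → S) : 0 ≤ matchTime i k ω := by
  classical
  rw [matchTime]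
  split_ifs with h
  · exact WithTop.coe_le_coe.2 (Int.natCast_nonneg _)
  · exact le_top

open scoped Classical in
/-- For a past `f`, the net supply at the times `-n, …, 0` before the demand at time `0` is
served. -/
def level (f : ℕ → S) (n : ℕ) : ℤ :=
  (if f 0 = i then 1 else 0) + ∑ l ∈ Finset.range n, charge i k (f (l + 1))

theorem level_succ (f : ℕ → S) (n : ℕ) :
    level i k f (n + 1) = level i k f n + charge i k (f (n + 1)) := by
  rw [level, level, Finset.sum_range_succ, add_assoc]

theorem level_zero_sub (f : ℕ → S) : level i k f 0 - k (f 0) = charge i k (f 0) := by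
  simp [level, charge]

/-- The balance started `t + 1 + j` steps ago, stopped before time 0, is an increment of `level`.
Positivity of all these balances thus says that `level` has a strict record. -/
theorem balance_shift_of_lt (ω : ℤ → S) (t j : ℕ) :
    balance i k (future (shift (-(t + 1 + j : ℕ)) ω)) t =
      level i k (past ω) (t + 1 + j) - level i k (past ω) j := by
  induction t generalizing j with
  | zero =>
    rw [show 0 + 1 + j = j + 1 by ring, level_succ]
    simp [balance, future, past]
  | succ t ih =>
    have h1 := ih (j + 1)
    rw [show t + 1 + (j + 1) = t + 1 + 1 + j by ring] at h1
    rw [balance, Finset.sum_range_succ]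
    rw [balance] at h1
    rw [h1, level_succ]
    have : future (shift (-((t + 1 + 1 + j : ℕ) : ℤ)) ω) (t + 1) = past ω (j + 1) := by
      simp only [future, past, shift_apply]
      congr 1; push_cast; ring
    rw [this]
    ring

/-- When the window reaches time 0, the demand there enters as well; `level` leaves it out. -/
theorem balance_shift_self (ω : ℤ → S) (n : ℕ) :
    balance i k (future (shift (-(n : ℤ)) ω)) n = level i k (past ω) n - k (ω 0) := by
  rcases n with _ | n
  · have := level_zero_sub i k (past ω)
    simpa [balance, future, past] using this.symm
  · have h1 := balance_shift_of_lt i k ω n 0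
    have h2 := level_zero_sub i k (past ω)
    rw [add_zero] at h1
    rw [balance] at h1
    rw [balance, Finset.sum_range_succ, h1]
    have h3 : future (shift (-((n + 1 : ℕ) : ℤ)) ω) (n + 1) = past ω 0 := by
      simp [future, past]
    rw [h3, ← h2]
    simp [past]

/-- The record times of `level` at which the record is at most the demand at time `0`. -/
def records (f : ℕ → S) : Set ℕ :=
  {n | f n = i ∧ level i k f n ≤ k (f 0) ∧ ∀ j < n, level i k f j < level i k f n}

theorem sources_matchTime (ω : ℤ → S) :
    sources i (matchTime i k) ω = (Nat.cast : ℕ → ℤ) '' records i k (past ω) := by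
  ext a
  simp only [sources, Set.mem_ofPred_eq, matchTime_eq_coe_iff, Set.mem_image, records]
  constructor
  · rintro ⟨h0, n, rfl, h1, h2⟩
    rw [balance_shift_self] at h1
    refine ⟨n, ⟨h0, sub_nonpos.1 h1, fun j hj => ?_⟩, rfl⟩
    obtain ⟨t, rfl⟩ : ∃ t, n = t + 1 + j := ⟨n - 1 - j, by omega⟩
    have := h2 t (by omega)
    rw [balance_shift_of_lt] at this
    exact sub_pos.1 this
  · rintro ⟨n, ⟨h0, h1, h2⟩, rfl⟩
    refine ⟨h0, n, rfl, ?_, fun t ht => ?_⟩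
    · rw [balance_shift_self]
      exact sub_nonpos.2 h1
    · obtain ⟨j, rfl⟩ : ∃ j, n = t + 1 + j := ⟨n - 1 - t, by omega⟩
      rw [balance_shift_of_lt]
      exact sub_pos.2 (h2 j (by omega))

theorem intake_matchTime (ω : ℤ → S) :
    intake i (matchTime i k) ω = (records i k (past ω)).encard := by
  rw [intake, sources_matchTime, Set.InjOn.encard_image Nat.cast_injective.injOn]

theorem encard_Icc_one (n : ℕ) : (Set.Icc (1 : ℤ) n).encard = n := by
  rw [← Finset.coe_Icc, Set.encard_coe_eq_coe_finsetCard, Int.card_Icc]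
  simp

theorem encard_records_le (f : ℕ → S) : (records i k f).encard ≤ k (f 0) := by
  rw [← encard_Icc_one]
  -- Record values are distinct, and at least 1 because `level` starts at 0 or 1 and a record at 0
  -- requires a visit to `i`.
  refine Set.encard_le_encard_of_injOn (f := level i k f) ?_ ?_
  · rintro n ⟨h0, h1, h2⟩
    refine ⟨?_, h1⟩
    have h3 : 0 ≤ level i k f 0 := by simp only [level]; split_ifs <;> simp
    rcases n with _ | n
    · simp [level, h0]
    · have := h2 0 (by omega)
      omega
  · intro a ha b hb hab
    by_contra hne
    rcases lt_or_gt_of_ne hne with h | h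
    · exact (hb.2.2 a h).ne hab
    · exact (ha.2.2 b h).ne hab.symm

theorem le_encard_records (f : ℕ → S) (h : ∃ n, (k (f 0) : ℤ) ≤ level i k f n) :
    (k (f 0) : ℕ∞) ≤ (records i k f).encard := by
  classical
  rw [← encard_Icc_one]
  refine le_trans (Set.encard_le_encard ?_) (Set.encard_image_le (level i k f) _)
  rintro c ⟨hc1, hc2⟩
  have hex : ∃ n, c ≤ level i k f n := h.imp fun n hn => hc2.trans hn
  have hspec := Nat.find_spec hex
  have hmin : ∀ j < Nat.find hex, level i k f j < c := fun j hj => not_le.1 (Nat.find_min hex hj)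
  -- Going back in time, `level` rises by at most 1 per step, and only at visits to `i`. So it first
  -- reaches `c` exactly, at such a visit.
  have key : f (Nat.find hex) = i ∧ level i k f (Nat.find hex) = c := by
    rcases hn : Nat.find hex with _ | n
    · rw [hn] at hspec
      have h0 : level i k f 0 = if f 0 = i then 1 else 0 := by simp [level]
      rw [h0] at hspec ⊢
      split_ifs at hspec ⊢ with h1
      · exact ⟨h1, by omega⟩
      · omega
    · rw [hn] at hspec hmin
      have h1 := hmin n (by omega)
      have h2 : charge i k (f (n + 1)) = (if f (n + 1) = i then 1 else 0) - k (f (n + 1)) := rfl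
      have h3 := level_succ i k f n
      split_ifs at h2 with h4
      · exact ⟨h4, by omega⟩
      · omega
  exact ⟨Nat.find hex, ⟨key.1, key.2.trans_le hc2, fun j hj => key.2.symm ▸ hmin j hj⟩, key.2⟩

theorem intake_matchTime_le (ω : ℤ → S) : intake i (matchTime i k) ω ≤ k (ω 0) := by
  rw [intake_matchTime]
  have := ENat.toENNReal_le.2 (encard_records_le i k (past ω))
  simpa [past] using this

theorem intake_matchTime_eq (ω : ℤ → S) (h : ∃ n, (k (past ω 0) : ℤ) ≤ level i k (past ω) n) :
    intake i (matchTime i k) ω = k (ω 0) := by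
  refine le_antisymm (intake_matchTime_le i k ω) ?_
  rw [intake_matchTime]
  have := ENat.toENNReal_le.2 (le_encard_records i k (past ω) h)
  simpa [past] using this

end Matching

section Measurable

variable [MeasurableSpace S] [MeasurableSingletonClass S] [Countable S] (i : S) (k : S → ℕ)

theorem measurable_balance (n : ℕ) : Measurable fun f : ℕ → S => balance i k f n := by
  unfold balance
  exact Finset.measurable_fun_sum _ fun l _ =>
    (Measurable.of_discrete (f := charge i k)).comp (measurable_pi_apply l)

theorem measurable_level (n : ℕ) : Measurable fun f : ℕ → S => level i k f n := by
  classical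
  unfold level
  refine Measurable.add ?_ (Finset.measurable_fun_sum _ fun l _ =>
    (Measurable.of_discrete (f := charge i k)).comp (measurable_pi_apply (l + 1)))
  exact (Measurable.of_discrete (f := fun x : S => if x = i then (1 : ℤ) else 0)).comp
    (measurable_pi_apply 0)

theorem measurable_matchTime : Measurable (matchTime (S := S) i k) := by
  classical
  refine measurable_of_Iic fun a => ?_
  induction a using WithTop.recTopCoe with
  | top => simp
  | coe a =>
    have : matchTime i k ⁻¹' Set.Iic (a : WithTop ℤ) =
        ⋃ n : ℕ, ⋃ _ : (n : ℤ) ≤ a, {ω | balance i k (future ω) n ≤ 0} := by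
      ext ω
      simp [matchTime_le_iff]
    rw [this]
    exact MeasurableSet.iUnion fun n => MeasurableSet.iUnion fun _ =>
      measurableSet_le ((measurable_balance i k n).comp measurable_future) measurable_const

theorem measurableSet_balance_pos : MeasurableSet {f : ℕ → S | ∀ n, 0 < balance i k f n} := by
  simp only [Set.ofPred_forall]
  exact MeasurableSet.iInter fun n => measurableSet_lt measurable_const (measurable_balance i k n)

theorem measurableSet_level_lt :
    MeasurableSet {f : ℕ → S | ∀ n, level i k f n < k (f 0)} := by
  simp only [Set.ofPred_forall]
  exact MeasurableSet.iInter fun n => measurableSet_lt (measurable_level i k n)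
    ((Measurable.of_discrete (f := fun x : S => (k x : ℤ))).comp (measurable_pi_apply 0))

end Measurable

/-! ### The matching time embeds `ν` -/

section Existence

variable [MeasurableSpace S] [MeasurableSingletonClass S] [Countable S]
variable (p : S → PMF S) (m : S → ℝ≥0) (hm : IsStationary p m)

/-- Unserved demands and unused supplies do not occur both. -/
theorem matched_dichotomy (hirr : IsIrreducible p) (hrec : IsRecurrent p) (i : S) (k : S → ℕ) :
    pathLaw p m hm i {ω | matchTime i k ω = ⊤} = 0 ∨
      statMeasure p m hm {ω | past ω ∈ {f | ∀ n, level i k f n < k (f 0)}} = 0 := by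
  by_contra! hne
  obtain ⟨hA, hB⟩ := hne
  have hF := measurableSet_level_lt i k
  have hG := measurableSet_balance_pos i k
  have hFω : MeasurableSet {ω : ℤ → S | past ω ∈ {f | ∀ n, level i k f n < k (f 0)}} :=
    measurable_past hF
  have hA' : chainLaw p i {f | ∀ n, 0 < balance i k f n} ≠ 0 := by
    rw [← pathLaw_future p m hm i hG]
    simpa [matchTime_eq_top_iff] using hA
  rw [statMeasure, mixLaw_apply p m hm _ hFω, ne_eq, ENNReal.tsum_eq_zero, not_forall] at hB
  obtain ⟨j, hj⟩ := hB
  obtain ⟨n, hn⟩ := hirr j i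
  have htail : Measurable fun (f : ℕ → S) (l : ℕ) => f (l + n) :=
    measurable_pi_lambda _ fun _ => measurable_pi_apply _
  have hGn : MeasurableSet {f : ℕ → S | f n = i ∧
      (fun l => f (l + n)) ∈ {f | ∀ n, 0 < balance i k f n}} :=
    (measurableSet_coord n i).inter (htail hG)
  -- A demand in state `j` at time 0 that the past cannot serve, followed by an unused supply at
  -- time `n`. Independence of past and future and irreducibility give this positive measure.
  have hE : MeasurableSet {ω : ℤ → S | past ω ∈ {f | ∀ n, level i k f n < k (f 0)} ∧
      future ω ∈ {f : ℕ → S | f n = i ∧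
        (fun l => f (l + n)) ∈ {f | ∀ n, 0 < balance i k f n}}} :=
    hFω.inter (measurable_future hGn)
  have hpos := statMeasure_state p m hm j hE
  rw [pathLaw_indep p m hm j hF hGn, pathLaw_future p m hm j hGn, chainLaw_markov p m hm n j i hG,
    ← mul_assoc] at hpos
  have hzero := statMeasure_eq_zero_of_bounded_return p m hm hrec j n
    ((measurableSet_coord 0 j).inter hE) (fun ω hω => hω.1) ?_
  · have h0 := hpos.symm.trans hzero
    exact mul_ne_zero hj (mul_ne_zero hn.ne' hA') h0
  -- The supply at time `n` is still unused at time `s`, so the balance over `n, …, s` is positive;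
  -- an unserved demand at `s` makes it negative.
  · rintro ω ⟨-, -, hω⟩ s hs ⟨-, hω', -⟩
    obtain ⟨t, rfl⟩ : ∃ t : ℕ, s = n + t := ⟨(s - n).toNat, by omega⟩
    have h1 := hω' t
    have h2 := hω.2 t
    have h3 := balance_shift_self i k (shift (n + t) ω) t
    have h4 : future (shift (-(t : ℤ)) (shift (n + t) ω)) = fun l => future ω (l + n) := by
      ext l
      simp only [future, shift_apply]
      congr 1; push_cast; ring
    rw [h4] at h3
    have h5 : past (shift (n + t) ω) 0 = shift (n + t) ω 0 := rfl
    rw [h5] at h1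
    omega

/-- Since `hk` makes the demand the density of `m i • mixLaw p m hm ν`, an almost everywhere
equality of intake and demand identifies the law in `transport`. -/
theorem setLIntegral_demand (i : S) (ν : PMF S) (k : S → ℕ)
    (hk : ∀ j, (m i : ℝ≥0∞) * ν j = k j * m j) {A : Set (ℤ → S)} (hA : MeasurableSet A) :
    ∫⁻ ω in A, (k (ω 0) : ℝ≥0∞) ∂statMeasure p m hm = m i * mixLaw p m hm ν A := by
  rw [statMeasure, mixLaw, Measure.restrict_sum _ hA, lintegral_sum_measure, mixLaw_apply p m hm ν hA,
    ← ENNReal.tsum_mul_left]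
  refine tsum_congr fun j => ?_
  rw [Measure.restrict_smul, lintegral_smul_measure, smul_eq_mul, ← mul_assoc, hk j]
  have : ∫⁻ ω in A, (k (ω 0) : ℝ≥0∞) ∂pathLaw p m hm j = ∫⁻ _ in A, k j ∂pathLaw p m hm j := by
    refine lintegral_congr_ae (ae_restrict_of_ae ?_)
    filter_upwards [pathLaw_ae_zero p m hm j] with ω hω
    rw [hω]
  rw [this, setLIntegral_const]
  ring

theorem mixLaw_univ (ν : PMF S) : mixLaw p m hm ν Set.univ = 1 := by
  simp [mixLaw_apply p m hm ν MeasurableSet.univ, ν.tsum_coe]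

theorem map_jump_matchTime (hirr : IsIrreducible p) (hrec : IsRecurrent p) (i : S) (ν : PMF S)
    (k : S → ℕ) (hk : ∀ j, (m i : ℝ≥0∞) * ν j = k j * m j) :
    (∀ᵐ ω ∂pathLaw p m hm i, matchTime i k ω ≠ ⊤) ∧
      (pathLaw p m hm i).map (jump (matchTime i k)) = mixLaw p m hm ν := by
  have hτ := measurable_matchTime i k
  have hi := hm.coe_ne_zero i
  have hdemand : Measurable fun ω : ℤ → S => (k (ω 0) : ℝ≥0∞) :=
    (Measurable.of_discrete (f := fun x : S => (k x : ℝ≥0∞))).comp (measurable_pi_apply 0)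
  have hae : intake i (matchTime i k) =ᵐ[statMeasure p m hm] fun ω => (k (ω 0) : ℝ≥0∞) := by
    rcases matched_dichotomy p m hm hirr hrec i k with h | h
    · have h1 := transport p m hm i hτ MeasurableSet.univ
      have h2 := setLIntegral_demand p m hm i ν k hk MeasurableSet.univ
      have h3 : pathLaw p m hm i {ω | matchTime i k ω ≠ ⊤ ∧
          jump (matchTime i k) ω ∈ Set.univ} = 1 := by
        rw [← measure_univ (μ := pathLaw p m hm i)]
        refine measure_congr ?_
        have h' : ∀ᵐ ω ∂pathLaw p m hm i, matchTime i k ω ≠ ⊤ := by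
          rw [ae_iff]; simpa using h
        filter_upwards [h'] with ω hω
        exact propext ⟨fun _ => trivial, fun _ => ⟨hω, trivial⟩⟩
      rw [h3, Measure.restrict_univ] at h1
      rw [mixLaw_univ, Measure.restrict_univ] at h2
      -- Both integrals equal `m i`, which is finite, so the pointwise inequality cannot be strict
      -- on a set of positive measure.
      refine ae_eq_of_ae_le_of_lintegral_le
        (Filter.Eventually.of_forall (intake_matchTime_le i k)) ?_ hdemand.aemeasurable
        (h2.trans h1).le
      rw [← h1]
      simp
    · have h' : ∀ᵐ ω ∂statMeasure p m hm, ¬ ∀ n, level i k (past ω) n < k (past ω 0) := by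
        rw [ae_iff]; simpa using h
      filter_upwards [h'] with ω hω
      push Not at hω
      exact intake_matchTime_eq i k ω hω
  have hlaw : ∀ A, MeasurableSet A →
      pathLaw p m hm i {ω | matchTime i k ω ≠ ⊤ ∧ jump (matchTime i k) ω ∈ A} =
        mixLaw p m hm ν A := by
    intro A hA
    rw [← ENNReal.mul_right_inj hi ENNReal.coe_ne_top, transport p m hm i hτ hA,
      ← setLIntegral_demand p m hm i ν k hk hA]
    exact lintegral_congr_ae (ae_restrict_of_ae hae)
  have hfin : ∀ᵐ ω ∂pathLaw p m hm i, matchTime i k ω ≠ ⊤ := by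
    -- Finiteness comes from comparing total masses, which covers the case where only the demands
    -- were known to be served.
    have h1 := hlaw Set.univ MeasurableSet.univ
    simp only [Set.mem_univ, and_true, mixLaw_univ] at h1
    exact (prob_compl_eq_zero_iff
      (hτ (measurableSet_singleton (⊤ : WithTop ℤ))).compl).2 h1
  refine ⟨hfin, ?_⟩
  ext A hA
  rw [Measure.map_apply (measurable_jump hτ) hA, ← hlaw A hA]
  refine measure_congr ?_
  filter_upwards [hfin] with ω hω
  exact propext (and_iff_right hω).symm

end Existence

end TwoSided
end

noncomputable section

namespace TwoSided

variable {S : Type*}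

/-! ### Embeddings -/

theorem exists_int_iff_exists_nat {p : S → PMF S} {m : S → ℝ≥0} (hm : IsStationary p m) (i j : S)
    (ν : PMF S) :
    (∃ k : ℤ, (m i : ℝ) / (m j : ℝ) * (ν j).toReal = (k : ℝ)) ↔
      ∃ k : ℕ, (m i : ℝ≥0∞) * ν j = k * m j := by
  have hj : (m j : ℝ) ≠ 0 := by exact_mod_cast (hm.1 j).ne'
  have key : ∀ k : ℕ, (m i : ℝ) / (m j : ℝ) * (ν j).toReal = (k : ℝ) ↔
      (m i : ℝ≥0∞) * ν j = k * m j := by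
    intro k
    rw [← ENNReal.toReal_eq_toReal_iff'
      (ENNReal.mul_ne_top ENNReal.coe_ne_top (PMF.apply_ne_top _ _))
      (ENNReal.mul_ne_top (ENNReal.natCast_ne_top k) ENNReal.coe_ne_top)]
    simp only [ENNReal.toReal_mul, ENNReal.coe_toReal, ENNReal.toReal_natCast]
    rw [div_mul_eq_mul_div, div_eq_iff hj]
  constructor
  · rintro ⟨k, hk⟩
    have h0 : (0 : ℝ) ≤ k := by rw [← hk]; positivity
    obtain ⟨n, rfl⟩ := Int.eq_ofNat_of_zero_le (by exact_mod_cast h0)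
    exact ⟨n, (key n).1 (by simpa using hk)⟩
  · rintro ⟨k, hk⟩
    exact ⟨k, by simpa using (key k).2 hk⟩

variable [Countable S] [MeasurableSpace S] [MeasurableSingletonClass S]

/-- Finiteness and the law of the shifted process depend on `P` only through the law of the
trajectory, so everything can be decided on path space. -/
theorem isEmbedding_iff {p : S → PMF S} {m : S → ℝ≥0} (hm : IsStationary p m)
    {Ω : Type*} [MeasurableSpace Ω] {P : Measure Ω} [IsProbabilityMeasure P]
    {X : ℤ → Ω → S} {i : S} (hX : IsTwoSidedChain p m (PMF.pure i) P X) (ν : PMF S)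
    {τ : (ℤ → S) → WithTop ℤ} (hτ : Measurable τ) :
    IsEmbedding p m ν P X (fun ω => τ fun n => X n ω) ↔
      (∀ᵐ ω ∂pathLaw p m hm i, τ ω ≠ ⊤) ∧
        (pathLaw p m hm i).map (jump τ) = mixLaw p m hm ν := by
  have hpath : Measurable fun ω n => X n ω := measurable_pi_lambda _ hX.measurable
  have hlaw : P.map (fun ω n => X n ω) = pathLaw p m hm i := by
    rw [(isTwoSidedChain_iff p m hm P _ X hX.measurable).1 hX, mixLaw_pure]
  have hshift : ∀ n, Measurable (shifted X (fun ω => τ fun n => X n ω) n) := fun n =>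
    (measurable_pi_apply n).comp ((measurable_jump hτ).comp hpath)
  have htop : MeasurableSet {ω | τ ω ≠ ⊤} :=
    (hτ (measurableSet_singleton (⊤ : WithTop ℤ))).compl
  rw [IsEmbedding, isTwoSidedChain_iff p m hm P ν _ hshift, ← hlaw,
    ae_map_iff hpath.aemeasurable htop,
    Measure.map_map (measurable_jump hτ) hpath]
  rfl

theorem isStoppingTime_matchTime {Ω : Type*} [MeasurableSpace Ω] (X : ℤ → Ω → S)
    (hX : ∀ n, Measurable (X n)) (i : S) (k : S → ℕ) :
    IsStoppingTime (forwardFiltration X hX) fun ω => matchTime i k fun n => X n ω := by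
  intro a
  have hset : {ω | (matchTime i k fun n => X n ω) ≤ a} =
      ⋃ n : ℕ, ⋃ _ : (n : ℤ) ≤ a, {ω | ∑ l ∈ Finset.range (n + 1), charge i k (X l ω) ≤ 0} := by
    ext ω
    simp [matchTime_le_iff, balance, future]
  rw [hset]
  refine MeasurableSet.iUnion fun n => MeasurableSet.iUnion fun hn => ?_
  refine measurableSet_le (Finset.measurable_fun_sum _ fun l hl => ?_) measurable_const
  refine (Measurable.of_discrete (f := charge i k)).comp ?_
  have hl' : (l : ℤ) ∈ Set.Icc (0 : ℤ) a := by
    have := Finset.mem_range.1 hl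
    exact ⟨by omega, by omega⟩
  exact (comap_measurable (X l)).mono
    (le_iSup₂_of_le (f := fun (k : ℤ) (_ : k ∈ Set.Icc (0 : ℤ) a) =>
      MeasurableSpace.comap (X k) _) (l : ℤ) hl' le_rfl) le_rfl

end TwoSided

end

theorem theorem1 {S : Type*} [Countable S] [MeasurableSpace S] [MeasurableSingletonClass S]
    (p : S → PMF S) (hirr : TwoSided.IsIrreducible p) (hrec : TwoSided.IsRecurrent p)
    (m : S → ℝ≥0) (hm : TwoSided.IsStationary p m)
    {Ω : Type*} [MeasurableSpace Ω] (P : Measure Ω) [IsProbabilityMeasure P]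
    (X : ℤ → Ω → S) (i : S) (hX : TwoSided.IsTwoSidedChain p m (PMF.pure i) P X)
    (ν : PMF S) :
    ((∃ T : Ω → WithTop ℤ, TwoSided.NonRandomized X T ∧ TwoSided.IsEmbedding p m ν P X T) ↔
      ∀ j : S, ∃ k : ℤ, (m i : ℝ) / (m j : ℝ) * (ν j).toReal = (k : ℝ)) ∧
    ((∃ T : Ω → WithTop ℤ, TwoSided.NonRandomized X T ∧ TwoSided.IsEmbedding p m ν P X T) →
      ∃ T : Ω → WithTop ℤ, TwoSided.NonRandomized X T ∧ TwoSided.IsEmbedding p m ν P X T ∧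
        (∀ ω, 0 ≤ T ω) ∧
        IsStoppingTime (TwoSided.forwardFiltration X hX.measurable) T) := by
  have necessity : (∃ T : Ω → WithTop ℤ, TwoSided.NonRandomized X T ∧
      TwoSided.IsEmbedding p m ν P X T) → ∀ j, ∃ k : ℕ, (m i : ℝ≥0∞) * ν j = k * m j := by
    rintro ⟨T, ⟨τ, hτ, hT⟩, hE⟩
    obtain rfl : T = fun ω => τ fun n => X n ω := funext hT
    obtain ⟨hfin, hmap⟩ := (TwoSided.isEmbedding_iff hm hX ν hτ).1 hE
    exact TwoSided.exists_nat_of_map_jump_eq p m hm i ν hτ hfin hmap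
  have sufficiency : (∀ j, ∃ k : ℕ, (m i : ℝ≥0∞) * ν j = k * m j) →
      ∃ T : Ω → WithTop ℤ, TwoSided.NonRandomized X T ∧ TwoSided.IsEmbedding p m ν P X T ∧
        (∀ ω, 0 ≤ T ω) ∧ IsStoppingTime (TwoSided.forwardFiltration X hX.measurable) T := by
    intro h
    choose k hk using h
    have hτ := TwoSided.measurable_matchTime i k
    exact ⟨fun ω => TwoSided.matchTime i k fun n => X n ω, ⟨_, hτ, fun _ => rfl⟩,
      (TwoSided.isEmbedding_iff hm hX ν hτ).2
        (TwoSided.map_jump_matchTime p m hm hirr hrec i ν k hk),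
      fun ω => TwoSided.matchTime_nonneg i k _,
      TwoSided.isStoppingTime_matchTime X hX.measurable i k⟩
  simp only [TwoSided.exists_int_iff_exists_nat hm i _ ν]
  refine ⟨⟨necessity, fun h => ?_⟩, fun h => sufficiency (necessity h)⟩
  obtain ⟨T, hT, hE, -⟩ := sufficiency h
  exact ⟨T, hT, hE⟩
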